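/- Let $G$ be a finite abelian group of order $n=|G|$, and let $S\subseteq G$ be a generating set of $G$ with $0_G\notin S$ and $S=-S$. Let $\mathrm{Cay}(G,S)$ be the undirected Cayley graph with vertex set $G$ in which $u,v$ are adjacent if and only if $v-u\in S$, and let $c(G,S)$ be its cop number, that is, the least number of cops that have a winning strategy in the game of cops and robbers on $\mathrm{Cay}(G,S)$. (First the cops and then the robber choose their initial vertices; then the cops and the robber move alternately, the cops first, and on each turn every token concerned stays where it is or moves to an adjacent vertex; several cops may share a vertex; the cops win if at some moment a cop occupies the same vertex as the robber.) Let $p$ be the smallest prime factor of $|G|$. 1. If $p=3$, then $c(G,S)\le \sqrt{\frac{3}{2(\sqrt3-1)e}}\,\sqrt n+\frac52$. 2. If $p\ge 5$, then $c(G,S)\le \sqrt{\frac2e}\,\sqrt n+\frac52$. Here, rounded to four decimal places, $\sqrt{\frac{3}{2(\sqrt3-1)e}}\approx 0.8682$ and $\sqrt{\frac2e}\approx 0.8578$; that is, each constant differs from the given decimal by less than $5\cdot10^{-5}$. -/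

import Mathlib

open scoped Pointwise

/-- Moves available in the game of cops and robbers on an undirected graph: a token at `u` may
stay at `u` or move to a vertex adjacent to `u`. -/
def IsMove {V : Type*} (Γ : SimpleGraph V) (u v : V) : Prop :=
  v = u ∨ Γ.Adj u v

/-- The list `[r (n - 1), …, r 1, r 0]` of the first `n` positions of the robber, the most recent
one first. -/
def robberHistory {V : Type*} (r : ℕ → V) : ℕ → List V
  | 0 => []
  | n + 1 => r n :: robberHistory r n

/-- A strategy for `k` cops (perfect information). `pos [] i` is the vertex at which cop `i` is
placed at the beginning of the game, and `pos [rₙ, …, r₁, r₀] i` is the vertex that cop `i` occupies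
after the cops' answer to the robber having occupied successively `r₀, r₁, …, rₙ`. Every answer must
consist of legal moves of the cops. Several cops may occupy the same vertex. -/
structure CopStrategy {V : Type*} (Γ : SimpleGraph V) (k : ℕ) where
  /-- The positions of the cops as a function of the history of the robber. -/
  pos : List V → Fin k → V
  /-- On each turn every cop stays put or moves to an adjacent vertex. -/
  legal : ∀ (h : List V) (v : V) (i : Fin k), IsMove Γ (pos h i) (pos (v :: h) i)

/-- A legal play of the robber: `r 0` is his arbitrary initial vertex, and on each turn he stays put
or moves to an adjacent vertex. -/
def IsRobberPlay {V : Type*} (Γ : SimpleGraph V) (r : ℕ → V) : Prop :=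
  ∀ n, IsMove Γ (r n) (r (n + 1))

/-- The strategy `σ` captures the robber who plays `r`: at some moment a cop and the robber occupy
the same vertex, either just after the robber has arrived at `r n`, or after the cops' answer. -/
def CopStrategy.Captures {V : Type*} {Γ : SimpleGraph V} {k : ℕ} (σ : CopStrategy Γ k)
    (r : ℕ → V) : Prop :=
  ∃ n i, σ.pos (robberHistory r n) i = r n ∨ σ.pos (robberHistory r (n + 1)) i = r n

/-- `k` cops have a winning strategy on `Γ`. -/
def CopsWin {V : Type*} (Γ : SimpleGraph V) (k : ℕ) : Prop :=
  ∃ σ : CopStrategy Γ k, ∀ r : ℕ → V, IsRobberPlay Γ r → σ.Captures r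

/-- The cop number of a graph: the least number of cops that have a winning strategy. -/
noncomputable def copNumber {V : Type*} (Γ : SimpleGraph V) : ℕ :=
  sInf {k : ℕ | CopsWin Γ k}

/-- On a finite graph the minimum defining the cop number is taken over a nonempty set. -/
theorem copsWin_card {V : Type*} [Finite V] (Γ : SimpleGraph V) : CopsWin Γ (Nat.card V) := by
  refine ⟨⟨fun _ i => (Finite.equivFin V).symm i, fun _ _ _ => Or.inl rfl⟩, fun r _ => ?_⟩
  exact ⟨0, Finite.equivFin V (r 0), Or.inl (by simp)⟩

/-- On a finite graph the minimum defining the cop number is attained. -/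
theorem copsWin_copNumber {V : Type*} [Finite V] (Γ : SimpleGraph V) :
    CopsWin Γ (copNumber Γ) :=
  Nat.sInf_mem (s := {k : ℕ | CopsWin Γ k}) ⟨_, copsWin_card Γ⟩

/-- For a symmetric set `S` not containing `0`, vertices `u` and `v` of the Cayley graph are
adjacent exactly when `v - u ∈ S`. -/
theorem addCayley_adj_iff_sub_mem {G : Type*} [AddCommGroup G] {S : Set G} (h0 : (0 : G) ∉ S)
    (hsymm : -S = S) (u v : G) : (SimpleGraph.addCayley S).Adj u v ↔ v - u ∈ S := by
  have key : u - v ∈ S ↔ v - u ∈ S := by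
    conv_lhs => rw [← hsymm]
    simp
  rw [SimpleGraph.addCayley_adj, neg_add_eq_sub, neg_add_eq_sub, key, or_self]
  refine ⟨fun h => h.2, fun h => ⟨?_, h⟩⟩
  rintro rfl
  exact h0 (by simpa using h)

/-! Let `T = S ∪ {0}` be the set of moves; only the differences robber minus cop matter. One cop can
make a whole set of robber moves harmless. Suppose the lead cop wins once his difference lies in a
proper subgroup `H`. Choose `δ ∉ H`, and let `A` be the set of robber moves that the lead cop can
answer so as to shift his difference by `δ` modulo `H`. Each move in `A` brings him a step closer to
`H`; against all other moves he copies the robber, keeping his difference, while the remaining cops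
play a robber deprived of `A`. Thus `H` grows to `H ⊔ ⟨δ⟩`, and eventually to the whole group
(`CopsCatch.succ`).

The price depends on how large `A` can be made. Let `T` meet `s` nonzero classes modulo `H`, and let
`q = |G/H|`. Averaging over `δ` in `G/H` gives a fraction of at least `max (s/(q-1)) (2/(s+2))` of
the current moves, and two moves whenever at least three remain (`exists_popular_shift`). With `ρ`
at most the smallest such fraction over proper `H`, about `log(Mρ/2)/ρ` cops shrink the at most `M`
moves to `2/ρ`, and `1/ρ` further cops remove these in pairs: this is `copCost`.

Let `H` attain the minimum. For `H = ⊥` the cost is governed by `√(2/e)·√n`. Otherwise `|T| ≤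
|H|(s+1)`, and the worst `s` is where the two fractions agree, which leaves a numerical inequality
in `|H|` and `q`. -/

/-! ### Estimates for the cost function -/

theorem log_three_le : Real.log 3 ≤ 11 / 10 := by
  have h : (3 : ℝ) ^ 10 ≤ Real.exp 11 := by
    have h1 : Real.exp 11 = Real.exp 1 ^ 11 := by rw [← Real.exp_nat_mul]; norm_num
    rw [h1]
    calc (3 : ℝ) ^ 10 ≤ 2.7182 ^ 11 := by norm_num
      _ ≤ _ := by gcongr; linarith [Real.exp_one_gt_d9]
  have := Real.log_le_log (by positivity) h
  rw [Real.log_exp, Real.log_pow] at this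
  push_cast at this; linarith

theorem log_five_le : Real.log 5 ≤ 81 / 50 := by
  have h : (5 : ℝ) ^ 50 ≤ Real.exp 81 := by
    have h1 : Real.exp 81 = Real.exp 1 ^ 81 := by rw [← Real.exp_nat_mul]; norm_num
    rw [h1]
    calc (5 : ℝ) ^ 50 ≤ 2.7182 ^ 81 := by norm_num
      _ ≤ _ := by gcongr; linarith [Real.exp_one_gt_d9]
  have := Real.log_le_log (by positivity) h
  rw [Real.log_exp, Real.log_pow] at this
  push_cast at this; linarith

theorem one_le_log {h : ℝ} (hh : 3 ≤ h) : 1 ≤ Real.log h := by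
  rw [Real.le_log_iff_exp_le (by linarith)]
  linarith [Real.exp_one_lt_d9]

/-- The bound on the number of cops obtained if each cop takes a fraction `ρ` of `M` moves. -/
noncomputable def copCost (M ρ : ℝ) : ℝ := 1 / ρ * (1 + Real.log (M * ρ / 2))

/-- The two fractions agree when `s(s+2) = 2(q-1)`, that is `s + 1 = X` with `X = √(2q-1)`. Below
this point the bound increases with `s`, so its value at `s + 1 = X` suffices. -/
theorem copCost_le_of_le {h s q X : ℝ} (hh : 3 ≤ h) (hs : 1 ≤ s) (hX : 2 ≤ X)
    (hXq : X ^ 2 = 2 * q - 1) (hle : s * (s + 2) ≤ 2 * (q - 1)) :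
    copCost (h * (s + 1)) (2 / (s + 2)) ≤ ((X + 1) * (1 + Real.log h) - 1) / 2 := by
  have hsX : s + 1 ≤ X := by nlinarith
  have hl := one_le_log hh
  have h1 : h * (s + 1) * (2 / (s + 2)) / 2 = h * ((s + 1) / (s + 2)) := by field_simp
  have h2 : Real.log ((s + 1) / (s + 2)) ≤ (s + 1) / (s + 2) - 1 :=
    Real.log_le_sub_one_of_pos (by positivity)
  rw [copCost, h1, Real.log_mul (by positivity) (by positivity), one_div_div]
  have h3 : (s + 2) / 2 * ((s + 1) / (s + 2) - 1) = -1 / 2 := by field_simp; ring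
  have h4 : (s + 2) / 2 * Real.log ((s + 1) / (s + 2)) ≤ -1 / 2 := by
    rw [← h3]; gcongr
  nlinarith

/-- Beyond the crossover the bound decreases with `s`: after linearising the logarithms, `s` enters
only through `y/s`, whose coefficient is nonnegative because `log h ≥ 1`. -/
theorem copCost_le_of_ge {h s q X : ℝ} (hh : 3 ≤ h) (hs : 1 ≤ s) (hX : 2 ≤ X)
    (hXq : X ^ 2 = 2 * q - 1) (hle : 2 * (q - 1) ≤ s * (s + 2)) :
    copCost (h * (s + 1)) (s / (q - 1)) ≤ ((X + 1) * (1 + Real.log h) - 1) / 2 := by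
  obtain ⟨y, rfl⟩ : ∃ y, X = y + 1 := ⟨X - 1, by ring⟩
  have hy : 1 ≤ y := by linarith
  have hq : q - 1 = y * (y + 2) / 2 := by linarith
  have hsX : y ≤ s := by nlinarith
  have hl := one_le_log hh
  have h1 : h * (s + 1) * (s / (q - 1)) / 2 = h * ((s / y) * ((s + 1) / (y + 2))) := by
    rw [hq]; field_simp
  have h2 : Real.log (s / y) ≤ s / y - 1 := Real.log_le_sub_one_of_pos (by positivity)
  have h3 : Real.log ((s + 1) / (y + 2)) ≤ (s + 1) / (y + 2) - 1 :=
    Real.log_le_sub_one_of_pos (by positivity)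
  rw [copCost, h1, Real.log_mul (by positivity) (by positivity),
    Real.log_mul (by positivity) (by positivity), one_div_div, hq]
  calc y * (y + 2) / 2 / s * (1 + (Real.log h + (Real.log (s / y) + Real.log ((s + 1) / (y + 2)))))
      ≤ y * (y + 2) / 2 / s * (1 + (Real.log h + (s / y - 1 + ((s + 1) / (y + 2) - 1)))) := by
        gcongr
    _ = (y / s * ((y + 2) * (Real.log h - 1) + 1) + (y + 2) + y) / 2 := by field_simp; ring
    _ ≤ (1 * ((y + 2) * (Real.log h - 1) + 1) + (y + 2) + y) / 2 := by
        have : y / s ≤ 1 := (div_le_one (by linarith)).2 hsX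
        have h5 : 0 ≤ (y + 2) * (Real.log h - 1) + 1 := by
          have := mul_nonneg (show 0 ≤ y + 2 by linarith) (sub_nonneg.2 hl)
          linarith
        gcongr
    _ = _ := by ring

theorem boundary_le_three {C X : ℝ} (hC : 0.8681 ≤ C) (hX : 2 ≤ X) :
    ((X + 1) * (1 + Real.log 3) - 1) / 2 ≤ C * Real.sqrt (3 * ((X ^ 2 + 1) / 2)) + 1 / 2 := by
  -- With `log 3 ≤ 1.1` the left side is at most `1.05 X + 0.55`; the line is chosen so that
  -- `0.8681` times it covers `1.05 X + 0.05`.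
  have h1 : 1.2096 * X + 0.0577 ≤ Real.sqrt (3 * ((X ^ 2 + 1) / 2)) := by
    apply Real.le_sqrt_of_sq_le; nlinarith
  have h2 := log_three_le
  have h3 : 0.8681 * (1.2096 * X + 0.0577) ≤ C * Real.sqrt (3 * ((X ^ 2 + 1) / 2)) := by
    gcongr
  nlinarith

theorem boundary_le_of_five_le {C X h : ℝ} (hC : 0.8577 ≤ C) (hX : 2 ≤ X) (hh : 5 ≤ h) :
    ((X + 1) * (1 + Real.log h) - 1) / 2 ≤ C * Real.sqrt (h * ((X ^ 2 + 1) / 2)) + 1 / 2 := by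
  -- Scaling by `Y` reduces to `h = 5`: after `log Y ≤ Y - 1` both sides are affine in `Y ≥ 1`, so
  -- it suffices to compare slopes (`h1`) and values at `Y = 1` (`h2`).
  set Y := Real.sqrt (h / 5)
  have hY : 1 ≤ Y := Real.one_le_sqrt.2 (by linarith)
  have hY2 : Y ^ 2 = h / 5 := Real.sq_sqrt (by linarith)
  set R := Real.sqrt (5 * ((X ^ 2 + 1) / 2))
  have hR : Real.sqrt (h * ((X ^ 2 + 1) / 2)) = Y * R := by
    rw [← Real.sqrt_mul (by linarith)]; congr 1; ring
  have h1 : X + 1 ≤ 0.8577 * R := by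
    rw [← div_le_iff₀' (by norm_num)]
    apply Real.le_sqrt_of_sq_le
    rw [div_pow, div_le_iff₀ (by norm_num)]; nlinarith
  have h2 : 1.31 * X + 0.31 ≤ 0.8577 * R := by
    rw [← div_le_iff₀' (by norm_num)]
    apply Real.le_sqrt_of_sq_le
    rw [div_pow, div_le_iff₀ (by norm_num)]
    nlinarith [sq_nonneg (X - 3.3)]
  have h3 : Real.log h ≤ 1.62 + 2 * (Y - 1) := by
    have e : h = 5 * Y ^ 2 := by rw [hY2]; ring
    rw [e, Real.log_mul (by norm_num) (by positivity), Real.log_pow]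
    have := Real.log_le_sub_one_of_pos (show 0 < Y by linarith)
    have := log_five_le
    push_cast; linarith
  rw [hR]
  have h4 : 0.8577 * (Y * R) ≤ C * (Y * R) := by gcongr
  have h5 : (X + 1) * (1 + Real.log h) ≤ (X + 1) * (2.62 + 2 * (Y - 1)) :=
    mul_le_mul_of_nonneg_left (by linarith) (by linarith)
  nlinarith [mul_nonneg (sub_nonneg.2 hY) (sub_nonneg.2 h1)]

theorem copCost_quotient_le {C h s q : ℝ} (hC : 0.8577 ≤ C)
    (hh : 5 ≤ h ∨ h = 3 ∧ 0.8681 ≤ C) (hs : 1 ≤ s) (hq : 3 ≤ q) :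
    2 ≤ h * (s + 1) * max (s / (q - 1)) (2 / (s + 2)) ∧
    copCost (h * (s + 1)) (max (s / (q - 1)) (2 / (s + 2))) ≤ C * Real.sqrt (h * q) + 1 / 2 := by
  have hh3 : 3 ≤ h := by rcases hh with hh | hh <;> linarith
  constructor
  · calc (2 : ℝ) ≤ h * (s + 1) * (2 / (s + 2)) := by
          rw [mul_div_assoc', le_div_iff₀ (by linarith)]; nlinarith
      _ ≤ _ := by gcongr; exact le_max_right _ _
  · set X := Real.sqrt (2 * q - 1)
    have hX2 : X ^ 2 = 2 * q - 1 := Real.sq_sqrt (by linarith)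
    have hX : 2 ≤ X := Real.le_sqrt_of_sq_le (by linarith)
    have e : h * q = h * ((X ^ 2 + 1) / 2) := by rw [hX2]; ring
    have key : copCost (h * (s + 1)) (max (s / (q - 1)) (2 / (s + 2)))
        ≤ ((X + 1) * (1 + Real.log h) - 1) / 2 := by
      rcases le_total (s * (s + 2)) (2 * (q - 1)) with hle | hle
      · rw [max_eq_right]
        · exact copCost_le_of_le hh3 hs hX hX2 hle
        · rwa [div_le_div_iff₀ (by linarith) (by linarith)]
      · rw [max_eq_left]
        · exact copCost_le_of_ge hh3 hs hX hX2 hle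
        · rwa [div_le_div_iff₀ (by linarith) (by linarith)]
    rw [e]
    refine key.trans ?_
    rcases hh with hh | ⟨rfl, hC'⟩
    · exact boundary_le_of_five_le hC hX hh
    · exact boundary_le_three hC' hX

/-- From `log w ≤ w/e` the cost is at most `B` with `B² = (2(n-1)/e)(s+1)/s`. For `A = √(2n/e)` the
excess `B² - A²` is below `A`, so `B ≤ A + 1/2`. -/
theorem copCost_self_le {s n : ℝ} (hs : 1 ≤ s) (hn : 3 ≤ n) (hle : 2 * (n - 1) ≤ s * (s + 1)) :
    copCost (s + 1) (s / (n - 1)) ≤ Real.sqrt (2 / Real.exp 1) * Real.sqrt n + 1 / 2 := by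
  set ν := n - 1
  have hν : 0 < ν := by simp only [ν]; linarith
  set w := Real.sqrt ((s + 1) * (s / ν) / 2 * Real.exp 1)
  have hw0 : 0 < w := Real.sqrt_pos.2 (by positivity)
  have hw2 : w ^ 2 = (s + 1) * (s / ν) / 2 * Real.exp 1 := Real.sq_sqrt (by positivity)
  have h1 : 1 + Real.log ((s + 1) * (s / ν) / 2) = 2 * Real.log w := by
    have : 2 * Real.log w = Real.log (w ^ 2) := by rw [Real.log_pow]; norm_num
    rw [this, hw2, Real.log_mul (by positivity) (by positivity), Real.log_exp, add_comm]
  have h2 : Real.log w ≤ w / Real.exp 1 := by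
    have := Real.log_le_sub_one_of_pos (show 0 < w / Real.exp 1 by positivity)
    rw [Real.log_div hw0.ne' (Real.exp_pos 1).ne', Real.log_exp] at this
    linarith
  rw [copCost, h1]
  set A := Real.sqrt (2 / Real.exp 1) * Real.sqrt n
  have hA0 : 0 ≤ A := by positivity
  have hA2 : A ^ 2 = 2 / Real.exp 1 * n := by
    rw [mul_pow, Real.sq_sqrt (by positivity), Real.sq_sqrt (by linarith)]
  have he := Real.exp_one_gt_d9
  set B := 1 / (s / ν) * (2 * (w / Real.exp 1))
  have hB0 : 0 ≤ B := by positivity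
  have hB2 : B ^ 2 = 2 * ν / Real.exp 1 * ((s + 1) / s) := by
    simp only [B]
    rw [mul_pow, mul_pow, div_pow w, hw2]; field_simp
  have hB : B ≤ A + 1 / 2 := by
    have hνs : ν / s ≤ (s + 1) / 2 := by rw [div_le_iff₀ (by linarith)]; linarith
    have e : B ^ 2 = 2 * ν / Real.exp 1 + 2 / Real.exp 1 * (ν / s) := by
      rw [hB2]; field_simp
    have hA2' : A ^ 2 = 2 * ν / Real.exp 1 + 2 / Real.exp 1 := by
      rw [hA2]; simp only [ν]; field_simp; ring
    have hv0 : 0 ≤ ν / s := by positivity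
    have hv2 : (ν / s) ^ 2 ≤ ν := by
      have hνs2 : ν ≤ s ^ 2 := by nlinarith
      rw [div_pow, div_le_iff₀ (by positivity), sq]
      gcongr
    have hc0 : 0 ≤ 2 / Real.exp 1 := by positivity
    have hc1 : 2 / Real.exp 1 ≤ 1 := by rw [div_le_one (by positivity)]; linarith
    have hvA : 2 / Real.exp 1 * (ν / s) ≤ A := by
      refine abs_le_of_sq_le_sq' ?_ hA0 |>.2
      calc (2 / Real.exp 1 * (ν / s)) ^ 2 = 2 / Real.exp 1 * (2 / Real.exp 1 * (ν / s) ^ 2) := by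
            ring
        _ ≤ 1 * (2 / Real.exp 1 * ν) := by gcongr
        _ ≤ A ^ 2 := by rw [hA2']; linarith [show 1 * (2 / Real.exp 1 * ν) = 2 * ν / Real.exp 1 by ring]
    refine abs_le_of_sq_le_sq' ?_ (by positivity) |>.2
    nlinarith
  refine le_trans ?_ hB
  simp only [B]; gcongr

/-! ### Decimal values and rounding -/

theorem sqrt_two_div_exp_bounds :
    0.85775 < Real.sqrt (2 / Real.exp 1) ∧ Real.sqrt (2 / Real.exp 1) < 0.85785 := by
  have h1 := Real.exp_one_gt_d9
  have h2 := Real.exp_one_lt_d9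
  constructor
  · apply Real.lt_sqrt_of_sq_lt
    rw [lt_div_iff₀ (by positivity)]; linarith
  · rw [Real.sqrt_lt' (by norm_num), div_lt_iff₀ (by positivity)]; linarith

theorem sqrt_three_div_bounds :
    0.86815 < Real.sqrt (3 / (2 * (Real.sqrt 3 - 1) * Real.exp 1)) ∧
      Real.sqrt (3 / (2 * (Real.sqrt 3 - 1) * Real.exp 1)) < 0.86825 := by
  have h1 := Real.exp_one_gt_d9
  have h2 := Real.exp_one_lt_d9
  have h3 : 1.73205 < Real.sqrt 3 := Real.lt_sqrt_of_sq_lt (by norm_num)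
  have h4 : Real.sqrt 3 < 1.73206 := by rw [Real.sqrt_lt' (by norm_num)]; norm_num
  have h5 : 0 < 2 * (Real.sqrt 3 - 1) * Real.exp 1 :=
    mul_pos (by linarith) (Real.exp_pos 1)
  constructor
  · apply Real.lt_sqrt_of_sq_lt
    rw [lt_div_iff₀ h5]; nlinarith
  · rw [Real.sqrt_lt' (by norm_num), div_lt_iff₀ h5]; nlinarith

/-- Since `(1-ρ)^i ≤ exp(-iρ)`, the chosen `i` leaves at most `2/ρ` moves. The floor plus one makes
`k > 1/ρ` strict, and each rounding costs at most one cop. -/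
theorem exists_nat_copCost {M ρ m : ℝ} (hρ0 : 0 < ρ) (hρ1 : ρ ≤ 1) (hm : m ≤ M)
    (hM : 2 ≤ M * ρ) : ∃ k i : ℕ, m * (1 - ρ) ^ i < 2 * k ∧ ((k + i : ℕ) : ℝ) ≤ copCost M ρ + 2 := by
  have hM0 : 0 < M := pos_of_mul_pos_left (by linarith) hρ0.le
  have hl : 0 ≤ Real.log (M * ρ / 2) := Real.log_nonneg (by linarith)
  refine ⟨⌊1 / ρ⌋₊ + 1, ⌈Real.log (M * ρ / 2) / ρ⌉₊, ?_, ?_⟩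
  · set i := ⌈Real.log (M * ρ / 2) / ρ⌉₊
    have hi : Real.log (M * ρ / 2) ≤ i * ρ := by
      rw [← div_le_iff₀ hρ0]; exact Nat.le_ceil _
    have h1 : (1 - ρ) ^ i ≤ 1 / (M * ρ / 2) := by
      calc (1 - ρ) ^ i ≤ Real.exp (-ρ) ^ i := by
            gcongr
            exact Real.one_sub_le_exp_neg ρ
        _ = Real.exp (-(i * ρ)) := by rw [← Real.exp_nat_mul]; congr 1; ring
        _ ≤ Real.exp (-Real.log (M * ρ / 2)) := by gcongr
        _ = _ := by rw [Real.exp_neg, Real.exp_log (by positivity), one_div]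
    have h2 : 1 / ρ < (⌊1 / ρ⌋₊ : ℝ) + 1 := Nat.lt_floor_add_one _
    calc m * (1 - ρ) ^ i ≤ M * (1 / (M * ρ / 2)) := by
          gcongr
      _ = 2 * (1 / ρ) := by field_simp
      _ < _ := by push_cast; linarith
  · have h1 := Nat.floor_le (show 0 ≤ 1 / ρ by positivity)
    have h2 := (Nat.ceil_lt_add_one (show 0 ≤ Real.log (M * ρ / 2) / ρ by positivity)).le
    have h3 : copCost M ρ = 1 / ρ + Real.log (M * ρ / 2) / ρ := by rw [copCost]; ring
    rw [h3]; push_cast; linarith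

/-! ### The game with restricted robber moves -/

/-- The cops, whose differences to the robber are `d`, catch a robber restricted to the moves in
`U`, the cops using moves in `T`. -/
inductive CopsCatch {G : Type*} [AddCommGroup G] (T U : Finset G) {k : ℕ} : (Fin k → G) → Prop
  | caught {d : Fin k → G} (i : Fin k) (h : d i = 0) : CopsCatch T U d
  | step {d : Fin k → G} (t : G → Fin k → G) (ht : ∀ u ∈ U, ∀ i, t u i ∈ T)
      (h : ∀ u ∈ U, CopsCatch T U (fun i => d i + u - t u i)) : CopsCatch T U d

/-- The robber's moves in `U` to which a cop can answer by changing the difference by `δ`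
modulo `H`. -/
noncomputable def shiftMoves {G : Type*} [AddCommGroup G] (T U : Finset G) (H : AddSubgroup G)
    (δ : G) : Finset G :=
  open Classical in U.filter fun u => ∃ t ∈ T, u - t - δ ∈ H

section Game
open Classical
variable {G : Type*} [AddCommGroup G] {T U : Finset G} {k : ℕ}

/-- Outer induction on the number `j` of shifts still needed, inner induction on the other cops' win
against the reduced move set. On a shift the other cops copy the robber; otherwise the lead cop
copies and the others advance. -/
theorem CopsCatch.cons_of_add_nsmul_mem (hU : U ⊆ T) {H : AddSubgroup G} {δ : G}
    (hgood : ∀ d : Fin k → G, CopsCatch T (U \ shiftMoves T U H δ) d)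
    (hH : ∀ x ∈ H, ∀ d : Fin k → G, CopsCatch T U (Fin.cons x d : Fin (k + 1) → G)) (j : ℕ) :
    ∀ x, x + j • δ ∈ H → ∀ d : Fin k → G, CopsCatch T U (Fin.cons x d : Fin (k + 1) → G) := by
  induction j with
  | zero => intro x hx; exact hH x (by simpa using hx)
  | succ j ih =>
    intro x hx d
    induction hgood d with
    | caught i h => exact .caught i.succ (by simpa using h)
    | @step d t ht h ih' =>
      have key : ∀ u : G, ∃ t' : G, u ∈ shiftMoves T U H δ → t' ∈ T ∧ u - t' - δ ∈ H := by
        intro u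
        by_cases hu : u ∈ shiftMoves T U H δ
        · obtain ⟨t', h1, h2⟩ := (Finset.mem_filter.1 hu).2
          exact ⟨t', fun _ => ⟨h1, h2⟩⟩
        · exact ⟨0, fun h => absurd h hu⟩
      choose t' ht' using key
      refine .step (fun u => if u ∈ shiftMoves T U H δ then Fin.cons (t' u) (fun _ => u)
        else Fin.cons u (t u)) ?_ ?_
      · intro u hu i
        by_cases huA : u ∈ shiftMoves T U H δ
        · simp only [huA, if_true]
          refine Fin.cases ?_ (fun i => ?_) i
          · simpa using (ht' u huA).1
          · simpa using hU hu
        · simp only [huA, if_false]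
          refine Fin.cases ?_ (fun i => ?_) i
          · simpa using hU hu
          · simpa using ht u (Finset.mem_sdiff.2 ⟨hu, huA⟩) i
      · intro u hu
        by_cases huA : u ∈ shiftMoves T U H δ
        · simp only [huA, if_true]
          convert ih (x + u - t' u) ?_ d using 1
          · funext i
            refine Fin.cases ?_ (fun i => ?_) i <;> simp
          · have := H.add_mem hx (ht' u huA).2
            convert this using 1
            rw [succ_nsmul]; abel
        · simp only [huA, if_false]
          convert ih' u (Finset.mem_sdiff.2 ⟨hu, huA⟩) using 1
          funext i
          refine Fin.cases ?_ (fun i => ?_) i <;> simp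

theorem CopsCatch.succ [Finite G] (hU : U ⊆ T)
    (h : ∀ H : AddSubgroup G, H ≠ ⊤ → ∃ δ ∉ H, ∀ d : Fin k → G,
      CopsCatch T (U \ shiftMoves T U H δ) d) (d : Fin (k + 1) → G) : CopsCatch T U d := by
  let C : AddSubgroup G → Prop := fun H =>
    ∀ x ∈ H, ∀ d : Fin k → G, CopsCatch T U (Fin.cons x d : Fin (k + 1) → G)
  have hbot : C ⊥ := fun x hx d => .caught 0 (by simpa using hx)
  obtain ⟨H, hHC, hmax⟩ := WellFounded.has_min
    (wellFounded_gt (α := AddSubgroup G)) {H | C H} ⟨⊥, hbot⟩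
  have htop : H = ⊤ := by
    by_contra hne
    obtain ⟨δ, hδ, hgood⟩ := h H hne
    refine hmax (H ⊔ AddSubgroup.zmultiples δ) ?_ ?_
    · intro x hx d
      obtain ⟨y, hy, z, hz, rfl⟩ := AddSubgroup.mem_sup.1 hx
      -- Finite order makes `-z` a natural multiple of `δ`, so `j` counts shifts in one direction.
      obtain ⟨j, hj⟩ := mem_multiples_iff_mem_zmultiples.2
        ((AddSubgroup.zmultiples δ).neg_mem hz)
      refine CopsCatch.cons_of_add_nsmul_mem hU hgood hHC j _ ?_ d
      simp only at hj
      rw [hj]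
      simpa using hy
    · refine lt_of_le_of_ne le_sup_left fun he => hδ ?_
      rw [he]
      exact (le_sup_right : AddSubgroup.zmultiples δ ≤ _) (AddSubgroup.mem_zmultiples δ)
  have := hHC (d 0) (by rw [htop]; trivial) (Fin.tail d)
  rwa [Fin.cons_self_tail] at this

/-- Each cop removes two moves while three or more remain, and at least one otherwise. A robber left
without moves has lost vacuously, even against no cops. -/
theorem CopsCatch.of_card_lt [Finite G]
    (hT : ∀ U ⊆ T, ∀ H : AddSubgroup G, H ≠ ⊤ → ∃ δ ∉ H,
      (U.Nonempty → 1 ≤ (shiftMoves T U H δ).card) ∧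
      (3 ≤ U.card → 2 ≤ (shiftMoves T U H δ).card)) (k : ℕ) :
    ∀ U ⊆ T, U.card < 2 * k → ∀ d : Fin k → G, CopsCatch T U d := by
  induction k with
  | zero => intro U _ h; omega
  | succ k ih =>
    intro U hU hcard
    refine CopsCatch.succ hU fun H hH => ?_
    obtain ⟨δ, hδ, h1, h2⟩ := hT U hU H hH
    refine ⟨δ, hδ, ?_⟩
    have hsub : shiftMoves T U H δ ⊆ U := Finset.filter_subset _ _
    have hc := Finset.card_sdiff_of_subset hsub
    have h1' : U.card = 0 ∨ 1 ≤ (shiftMoves T U H δ).card := by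
      rcases U.eq_empty_or_nonempty with h | h
      · left; simp [h]
      · exact Or.inr (h1 h)
    rcases Nat.eq_zero_or_pos k with rfl | hk
    · intro d
      have : U \ shiftMoves T U H δ = ∅ := by
        rw [← Finset.card_eq_zero]; omega
      rw [this]
      exact .step (fun _ _ => 0) (by simp) (by simp)
    · refine ih _ (Finset.sdiff_subset.trans hU) ?_
      by_cases h3 : 3 ≤ U.card
      · have := h2 h3; omega
      · omega

theorem CopsCatch.of_card_mul_pow_lt [Finite G] {ρ : ℝ} (hρ : ρ ≤ 1)
    (hT : ∀ U ⊆ T, ∀ H : AddSubgroup G, H ≠ ⊤ → ∃ δ ∉ H,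
      (U.Nonempty → 1 ≤ (shiftMoves T U H δ).card) ∧
      (3 ≤ U.card → 2 ≤ (shiftMoves T U H δ).card) ∧
      ρ * U.card ≤ (shiftMoves T U H δ).card) (k i : ℕ) :
    ∀ U ⊆ T, U.card * (1 - ρ) ^ i < 2 * k → ∀ d : Fin (k + i) → G, CopsCatch T U d := by
  induction i with
  | zero =>
    intro U hU h
    refine CopsCatch.of_card_lt (fun U hU H hH => ?_) k U hU ?_
    · obtain ⟨δ, h0, h1, h2, -⟩ := hT U hU H hH
      exact ⟨δ, h0, h1, h2⟩
    · simp only [pow_zero, mul_one] at h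
      exact_mod_cast h
  | succ i ih =>
    intro U hU h
    refine CopsCatch.succ (k := k + i) hU fun H hH => ?_
    obtain ⟨δ, hδ, -, -, h3⟩ := hT U hU H hH
    refine ⟨δ, hδ, ih _ (Finset.sdiff_subset.trans hU) (lt_of_le_of_lt ?_ h)⟩
    have hsub : shiftMoves T U H δ ⊆ U := Finset.filter_subset _ _
    rw [Finset.cast_card_sdiff hsub, pow_succ', ← mul_assoc]
    refine mul_le_mul_of_nonneg_right ?_ (pow_nonneg (by linarith) i)
    linarith

/-! ### From the inductive game to actual plays -/

/-- The cops catch the robber after at most `m` answers. -/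
def CatchWithin (T U : Finset G) {k : ℕ} : ℕ → (Fin k → G) → Prop
  | 0, d => ∃ i, d i = 0
  | m + 1, d => (∃ i, d i = 0) ∨ ∃ t : G → Fin k → G, (∀ u ∈ U, ∀ i, t u i ∈ T) ∧
      ∀ u ∈ U, CatchWithin T U m (fun i => d i + u - t u i)

theorem CatchWithin.succ {m : ℕ} : ∀ {d : Fin k → G}, CatchWithin T U m d →
    CatchWithin T U (m + 1) d := by
  induction m with
  | zero => intro d h; exact Or.inl h
  | succ m ih =>
    rintro d (h | ⟨t, h1, h2⟩)
    · exact Or.inl h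
    · exact Or.inr ⟨t, h1, fun u hu => ih (h2 u hu)⟩

theorem CatchWithin.mono {m m' : ℕ} (h : m ≤ m') {d : Fin k → G} (hd : CatchWithin T U m d) :
    CatchWithin T U m' d := by
  induction h with
  | refl => exact hd
  | step _ ih => exact ih.succ

theorem CopsCatch.exists_catchWithin {d : Fin k → G} (h : CopsCatch T U d) :
    ∃ m, CatchWithin T U m d := by
  induction h with
  | caught i h => exact ⟨0, i, h⟩
  | step t ht _ ih =>
    choose! f hf using ih
    exact ⟨U.sup f + 1, Or.inr ⟨t, ht, fun u hu => (hf u hu).mono (Finset.le_sup hu)⟩⟩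

/-- A single positional strategy works for all time bounds at once. -/
theorem exists_response (h0 : (0 : G) ∈ T) (k : ℕ) :
    ∃ τ : (Fin k → G) → G → Fin k → G, (∀ d u i, τ d u i ∈ T) ∧
      ∀ m d, CatchWithin T U (m + 1) d → (∃ i, d i = 0) ∨
        ∀ u ∈ U, CatchWithin T U m (fun i => d i + u - τ d u i) := by
  have key : ∀ d : Fin k → G, ∃ t : G → Fin k → G, (∀ u i, t u i ∈ T) ∧
      ∀ m, CatchWithin T U (m + 1) d → (∃ i, d i = 0) ∨
        ∀ u ∈ U, CatchWithin T U m (fun i => d i + u - t u i) := by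
    intro d
    by_cases hd : ∃ m, CatchWithin T U (m + 1) d
    -- Playing for the least possible time bound is also good for every larger one.
    · rcases Nat.find_spec hd with h | ⟨t, ht, h⟩
      · exact ⟨fun _ _ => 0, fun _ _ => h0, fun _ _ => Or.inl h⟩
      · refine ⟨fun u i => if u ∈ U then t u i else 0, fun u i => ?_, fun m hm => Or.inr ?_⟩
        · dsimp only
          split_ifs with hu
          · exact ht u hu i
          · exact h0
        · intro u hu
          simpa [hu] using (h u hu).mono (Nat.find_min' hd hm)
    · exact ⟨fun _ _ => 0, fun _ _ => h0, fun m hm => absurd ⟨m, hm⟩ hd⟩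
  choose τ h1 h2 using key
  exact ⟨τ, h1, fun m d => h2 d m⟩

/-- The positions of cops starting at `0` that answer each move of the robber according to `τ`. -/
def responsePos (τ : (Fin k → G) → G → Fin k → G) : List G → Fin k → G
  | [] => fun _ => 0
  | [_] => fun _ => 0
  | v :: w :: h => fun i => responsePos τ (w :: h) i +
      τ (fun i => w - responsePos τ (w :: h) i) (v - w) i

theorem copsWin_of_copsCatch {S : Set G} (h0 : (0 : G) ∉ S) (hsymm : -S = S)
    (hT : ∀ x, x ∈ T ↔ x = 0 ∨ x ∈ S) (h : ∀ d : Fin k → G, CopsCatch T T d) :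
    CopsWin (SimpleGraph.addCayley S) k := by
  have hmove : ∀ u v : G, IsMove (SimpleGraph.addCayley S) u v ↔ v - u ∈ T := fun u v => by
    rw [IsMove, addCayley_adj_iff_sub_mem h0 hsymm, hT, sub_eq_zero]
  have h0T : (0 : G) ∈ T := (hT 0).2 (Or.inl rfl)
  obtain ⟨τ, hτ, hstep⟩ := exists_response (U := T) h0T k
  refine ⟨⟨responsePos τ, ?_⟩, fun r hr => ?_⟩
  · rintro (_ | ⟨w, h⟩) v i
    · exact Or.inl rfl
    · rw [hmove]
      simpa [responsePos] using hτ _ _ i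
  · have main : ∀ m n, CatchWithin T T m
        (fun i => r n - responsePos τ (robberHistory r (n + 1)) i) →
        ∃ n i, responsePos τ (robberHistory r (n + 1)) i = r n := by
      intro m
      induction m with
      | zero =>
        rintro n ⟨i, hi⟩
        exact ⟨n, i, (sub_eq_zero.1 hi).symm⟩
      | succ m ih =>
        intro n hn
        rcases hstep m _ hn with ⟨i, hi⟩ | hn'
        · exact ⟨n, i, (sub_eq_zero.1 hi).symm⟩
        · refine ih (n + 1) ?_
          convert hn' (r (n + 1) - r n) ((hmove _ _).1 (hr n)) using 2 with i
          simp only [robberHistory, responsePos]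
          abel
    obtain ⟨m, hm⟩ := (h fun i => r 0 - responsePos τ (robberHistory r 1) i).exists_catchWithin
    obtain ⟨n, i, hi⟩ := main m 0 hm
    exact ⟨n, i, Or.inr hi⟩

end Game

/-! ### Popular shifts in a quotient -/

section Counting
open Classical
variable {Q : Type*} [AddCommGroup Q] {B : Finset Q}

/-- With `s = |B| - 1`, there are `s(s+1)` ordered pairs in `B` with nonzero sum. A nonzero sum is
represented at least twice unless it is a double `x + x`, and at most `s` sums are such exceptions.
-/
theorem two_mul_card_nonzero_sums_le (hB0 : (0 : Q) ∈ B)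
    (hneg : ∀ x ∈ B, -x ∈ B) :
    2 * ((B + B).erase 0).card ≤ (B.card - 1) * (B.card - 1 + 2) := by
  set D := (B + B).erase 0
  set r : Q → ℕ := fun δ => (B.filter fun x => δ - x ∈ B).card
  have hsum : ∑ δ ∈ D, r δ = B.card * (B.card - 1) := by
    have h1 : ∑ δ ∈ D, r δ = ∑ x ∈ B, (D.filter fun δ => δ - x ∈ B).card :=
      Finset.sum_card_bipartiteAbove_eq_sum_card_bipartiteBelow (fun δ x => δ - x ∈ B)
    rw [h1, Finset.sum_const_nat (m := B.card - 1)]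
    intro x hx
    have hx' := hneg x hx
    rw [← Finset.card_erase_of_mem hx']
    refine Finset.card_bij' (fun δ _ => δ - x) (fun y _ => y + x) ?_ ?_ ?_ ?_
    · intro δ hδ
      simp only [D, Finset.mem_filter, Finset.mem_erase] at hδ ⊢
      refine ⟨fun h => hδ.1.1 ?_, hδ.2⟩
      rw [sub_eq_iff_eq_add] at h; simpa using h
    · intro y hy
      simp only [D, Finset.mem_filter, Finset.mem_erase] at hy ⊢
      refine ⟨⟨fun h => hy.1 (eq_neg_of_add_eq_zero_left h), Finset.add_mem_add hy.2 hx⟩, ?_⟩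
      simpa using hy.2
    · intro δ _; simp
    · intro y _; simp
  have hone : (D.filter fun δ => r δ < 2).card ≤ B.card - 1 := by
    rw [← Finset.card_erase_of_mem hB0]
    have key : ∀ δ ∈ D.filter (fun δ => r δ < 2), ∃ x ∈ B.erase 0, δ = x + x := by
      intro δ hδ
      simp only [D, Finset.mem_filter, Finset.mem_erase, Finset.mem_add] at hδ
      obtain ⟨⟨h0, x, hx, y, hy, rfl⟩, hr⟩ := hδ
      have hxy : x = y := by
        have : r (x + y) ≤ 1 := by omega
        refine Finset.card_le_one.1 this x ?_ y ?_ <;> simp [hx, hy]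
      subst hxy
      refine ⟨x, Finset.mem_erase.2 ⟨?_, hx⟩, rfl⟩
      rintro rfl; simp at h0
    refine (Finset.card_le_card (t := (B.erase 0).image fun x => x + x) ?_).trans
      Finset.card_image_le
    intro δ hδ
    obtain ⟨x, hx, rfl⟩ := key δ hδ
    exact Finset.mem_image_of_mem _ hx
  have hpos : ∀ δ ∈ D, 2 ≤ r δ + if r δ < 2 then 1 else 0 := by
    intro δ hδ
    simp only [D, Finset.mem_erase, Finset.mem_add] at hδ
    obtain ⟨h0, x, hx, y, hy, rfl⟩ := hδ
    have : 1 ≤ r (x + y) := Finset.card_pos.2 ⟨x, by simp [hx, hy]⟩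
    split_ifs <;> omega
  have h2 := Finset.sum_le_sum hpos
  rw [Finset.sum_const, Finset.sum_add_distrib, ← Finset.card_filter, hsum, smul_eq_mul] at h2
  have h3 : 1 ≤ B.card := Finset.card_pos.2 ⟨0, hB0⟩
  obtain ⟨s, hs⟩ : ∃ s, B.card = s + 1 := ⟨B.card - 1, by omega⟩
  rw [hs] at h2 hone ⊢
  simp only [Nat.add_sub_cancel] at *
  nlinarith

/-- A most popular nonzero `δ` satisfies all three bounds. Each `u` admits the `|B| - 1` shifts `f u
- y` with `y ∈ B`, `y ≠ f u`; averaging over all nonzero `δ`, or only over nonzero elements of `B +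
B`, gives the first two. -/
theorem exists_popular_shift [Fintype Q] {α : Type*} (hB0 : (0 : Q) ∈ B)
    (hneg : ∀ x ∈ B, -x ∈ B)
    (hB2 : 2 ≤ B.card) (hodd : ∀ x : Q, x + x = 0 → x = 0) (U : Finset α) (f : α → Q)
    (hf : ∀ u ∈ U, f u ∈ B) :
    ∃ δ : Q, δ ≠ 0 ∧ ∀ A : Finset α, (∀ u, u ∈ A ↔ u ∈ U ∧ f u - δ ∈ B) →
      U.card * (B.card - 1) ≤ A.card * (Fintype.card Q - 1) ∧
      2 * U.card ≤ A.card * (B.card - 1 + 2) ∧ (3 ≤ U.card → 2 ≤ A.card) := by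
  set N : Q → ℕ := fun δ => (U.filter fun u => f u - δ ∈ B).card
  obtain ⟨b, hb, hb0⟩ : ∃ b ∈ B, b ≠ 0 := Finset.exists_mem_ne (by omega) 0
  obtain ⟨δ, hδ, hmax⟩ := (Finset.univ.erase (0 : Q)).exists_max_image N ⟨b, by simpa using hb0⟩
  have hsum : ∀ D ⊆ Finset.univ.erase (0 : Q), (B + B).erase 0 ⊆ D →
      U.card * (B.card - 1) ≤ N δ * D.card := by
    intro D hD hBD
    have h1 : ∑ δ ∈ D, N δ = ∑ u ∈ U, (D.filter fun δ => f u - δ ∈ B).card :=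
      Finset.sum_card_bipartiteAbove_eq_sum_card_bipartiteBelow (fun δ u => f u - δ ∈ B)
    have h2 : U.card * (B.card - 1) ≤ ∑ δ ∈ D, N δ := by
      rw [h1, ← smul_eq_mul]
      refine Finset.card_nsmul_le_sum _ _ _ fun u hu => ?_
      rw [← Finset.card_erase_of_mem (hf u hu)]
      refine Finset.card_le_card_of_injOn (fun y => f u - y) ?_
        (fun x _ y _ h => sub_right_injective h)
      intro y hy
      have hy' := Finset.mem_erase.1 (Finset.mem_coe.1 hy)
      simp only [Finset.coe_filter, Set.mem_ofPred_eq, sub_sub_cancel]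
      refine ⟨hBD (Finset.mem_erase.2 ⟨sub_ne_zero.2 (Ne.symm hy'.1), ?_⟩), hy'.2⟩
      rw [sub_eq_add_neg]
      exact Finset.add_mem_add (hf u hu) (hneg y hy'.2)
    refine h2.trans ?_
    rw [mul_comm, ← smul_eq_mul]
    exact Finset.sum_le_card_nsmul _ _ _ fun x hx => hmax x (hD hx)
  refine ⟨δ, by simpa using hδ, fun A hA => ?_⟩
  obtain rfl : A = U.filter fun u => f u - δ ∈ B := by ext; simp [hA]
  refine ⟨?_, ?_, ?_⟩
  · have := hsum _ subset_rfl (Finset.erase_subset_erase _ (Finset.subset_univ _))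
    rwa [Finset.card_erase_of_mem (Finset.mem_univ _), Finset.card_univ] at this
  · have h1 := hsum _ (Finset.erase_subset_erase _ (Finset.subset_univ _)) subset_rfl
    have h2 := two_mul_card_nonzero_sums_le hB0 hneg
    have h3 : 0 < B.card - 1 := by omega
    refine Nat.le_of_mul_le_mul_right ?_ h3
    calc 2 * U.card * (B.card - 1) = 2 * (U.card * (B.card - 1)) := by ring
      _ ≤ 2 * (N δ * ((B + B).erase 0).card) := by gcongr
      _ = N δ * (2 * ((B + B).erase 0).card) := by ring
      _ ≤ N δ * ((B.card - 1) * (B.card - 1 + 2)) := by gcongr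
      _ = _ := by ring
  · intro hU
    by_cases h : ∃ u ∈ U, ∃ v ∈ U, u ≠ v ∧ f u + f v ≠ 0
    · obtain ⟨u, hu, v, hv, huv, hne⟩ := h
      refine le_trans ?_ (hmax (f u + f v) (by simpa using hne))
      refine Finset.one_lt_card.2 ⟨u, ?_, v, ?_, huv⟩
      · simpa [hu] using hneg _ (hf v hv)
      · simpa [hv] using hneg _ (hf u hu)
    · push Not at h
      have hzero : ∀ u ∈ U, f u = 0 := by
        intro u hu
        have h2 : 1 < (U.erase u).card := by rw [Finset.card_erase_of_mem hu]; omega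
        obtain ⟨v, hv, w, hw, hvw⟩ := Finset.one_lt_card.1 h2
        rw [Finset.mem_erase] at hv hw
        apply hodd
        calc f u + f u = (f u + f v) + (f u + f w) - (f v + f w) := by abel
          _ = 0 := by
            rw [h u hu v hv.2 hv.1.symm, h u hu w hw.2 hw.1.symm, h v hv.2 w hw.2 hvw]; simp
      refine le_trans ?_ (hmax b (by simpa using hb0))
      have : (U.filter fun u => f u - b ∈ B) = U := by
        refine Finset.filter_true_of_mem fun u hu => ?_
        rw [hzero u hu, zero_sub]; exact hneg b hb
      simp only [N, this]; omega

end Counting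

/-! ### Densities modulo subgroups and the choice of `H` -/

section Quotient
open Classical
variable {G : Type*} [AddCommGroup G] {T : Finset G}

/-- The number of nonzero classes modulo `H` that meet `T ∋ 0`. -/
noncomputable def classCount (T : Finset G) (H : AddSubgroup G) : ℕ :=
  (T.image (QuotientAddGroup.mk' H)).card - 1

/-- The fraction of the moves that a cop can answer by a suitable shift modulo `H`. -/
noncomputable def shiftDensity (T : Finset G) (H : AddSubgroup G) : ℝ :=
  max (classCount T H / ((Nat.card (G ⧸ H) : ℝ) - 1)) (2 / ((classCount T H : ℝ) + 2))

theorem two_le_card_image_mk (hT0 : (0 : G) ∈ T) (hgen : AddSubgroup.closure (T : Set G) = ⊤)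
    {H : AddSubgroup G} (hH : H ≠ ⊤) : 2 ≤ (T.image (QuotientAddGroup.mk' H)).card := by
  have : ∃ x ∈ T, x ∉ H := by
    by_contra! h
    exact hH (top_le_iff.1 (hgen ▸ (AddSubgroup.closure_le H).2 h))
  obtain ⟨x, hx, hxH⟩ := this
  refine Finset.one_lt_card.2 ⟨QuotientAddGroup.mk' H x, Finset.mem_image_of_mem _ hx, 0,
    Finset.mem_image.2 ⟨0, hT0, map_zero _⟩, ?_⟩
  simpa using hxH

theorem one_le_classCount (hT0 : (0 : G) ∈ T) (hgen : AddSubgroup.closure (T : Set G) = ⊤)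
    {H : AddSubgroup G} (hH : H ≠ ⊤) : 1 ≤ classCount T H := by
  have := two_le_card_image_mk hT0 hgen hH
  rw [classCount]; omega

theorem card_le_mul_classCount [Finite G] (hT0 : (0 : G) ∈ T) (hgen : AddSubgroup.closure (T : Set G) = ⊤)
    {H : AddSubgroup G} (hH : H ≠ ⊤) : T.card ≤ Nat.card H * (classCount T H + 1) := by
  have h2 := two_le_card_image_mk hT0 hgen hH
  have e : classCount T H + 1 = (T.image (QuotientAddGroup.mk' H)).card := by
    rw [classCount]; omega
  rw [e]
  refine Finset.card_le_mul_card_image T _ fun b hb => ?_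
  obtain ⟨x, hx, rfl⟩ := Finset.mem_image.1 hb
  have := Fintype.ofFinite H
  rw [Nat.card_eq_fintype_card, ← Finset.card_univ]
  have hmem : ∀ a ∈ T.filter (fun a => QuotientAddGroup.mk' H a = QuotientAddGroup.mk' H x),
      -x + a ∈ H := fun a ha =>
    QuotientAddGroup.eq.1 (Finset.mem_filter.1 ha).2.symm
  refine Finset.card_le_card_of_injOn
    (fun a => if h : -x + a ∈ H then (⟨-x + a, h⟩ : H) else 0) (by simp) ?_
  intro a ha b hb hab
  simp only [hmem a ha, hmem b hb, dif_pos, Subtype.mk.injEq] at hab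
  exact add_left_cancel hab

theorem exists_shiftMoves [Finite G] (hT0 : (0 : G) ∈ T) (hneg : ∀ x ∈ T, -x ∈ T) (hodd : Odd (Nat.card G))
    (hgen : AddSubgroup.closure (T : Set G) = ⊤) {U : Finset G} (hU : U ⊆ T)
    {H : AddSubgroup G} (hH : H ≠ ⊤) : ∃ δ ∉ H,
      (U.Nonempty → 1 ≤ (shiftMoves T U H δ).card) ∧
      (3 ≤ U.card → 2 ≤ (shiftMoves T U H δ).card) ∧
      shiftDensity T H * U.card ≤ (shiftMoves T U H δ).card := by
  set π := QuotientAddGroup.mk' H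
  have := Fintype.ofFinite (G ⧸ H)
  have hB2 := two_le_card_image_mk hT0 hgen hH
  have hs1 := one_le_classCount hT0 hgen hH
  have hB0 : (0 : G ⧸ H) ∈ T.image π := Finset.mem_image.2 ⟨0, hT0, map_zero _⟩
  have hBneg : ∀ x ∈ T.image π, -x ∈ T.image π := by
    intro x hx
    obtain ⟨a, ha, rfl⟩ := Finset.mem_image.1 hx
    exact Finset.mem_image.2 ⟨-a, hneg a ha, map_neg _ _⟩
  have hoddQ : ∀ x : G ⧸ H, x + x = 0 → x = 0 := by
    intro x hx
    have h1 : addOrderOf x ∣ 2 := addOrderOf_dvd_of_nsmul_eq_zero (by rwa [two_nsmul])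
    have h2 : addOrderOf x ∣ Nat.card G :=
      (addOrderOf_dvd_natCard x).trans (AddSubgroup.card_quotient_dvd_card H)
    have h3 : addOrderOf x ∣ Nat.gcd 2 (Nat.card G) := Nat.dvd_gcd h1 h2
    rw [(Nat.coprime_two_left.2 hodd).gcd_eq_one] at h3
    exact AddMonoid.addOrderOf_eq_one_iff.1 (Nat.dvd_one.1 h3)
  obtain ⟨δ', hδ0, hA⟩ := exists_popular_shift hB0 hBneg hB2 hoddQ U π
    (fun u hu => Finset.mem_image_of_mem _ (hU hu))
  obtain ⟨δ, rfl⟩ : ∃ δ, π δ = δ' := QuotientAddGroup.mk'_surjective H δ'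
  have hδ : δ ∉ H := fun h => hδ0 ((QuotientAddGroup.eq_zero_iff δ).2 h)
  obtain ⟨h1, h2, h3⟩ := hA (shiftMoves T U H δ) fun u => by
    rw [shiftMoves, Finset.mem_filter, Finset.mem_image]
    refine and_congr_right fun _ => exists_congr fun t => and_congr_right fun _ => ?_
    rw [eq_comm, ← sub_eq_zero, ← map_sub, ← map_sub, show u - δ - t = u - t - δ by abel]
    exact (QuotientAddGroup.eq_zero_iff _).symm
  change _ * classCount T H ≤ _ at h1
  change _ ≤ _ * (classCount T H + 2) at h2
  have hq : 2 ≤ Nat.card (G ⧸ H) := by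
    rw [Nat.card_eq_fintype_card]; exact hB2.trans (Finset.card_le_univ _)
  have h1' : (U.card : ℝ) * classCount T H ≤
      (shiftMoves T U H δ).card * ((Nat.card (G ⧸ H) : ℝ) - 1) := by
    rw [← Nat.card_eq_fintype_card] at h1
    rw [← Nat.cast_one, ← Nat.cast_sub (by omega)]
    exact_mod_cast h1
  have h2' : 2 * (U.card : ℝ) ≤ (shiftMoves T U H δ).card * ((classCount T H : ℝ) + 2) := by
    exact_mod_cast h2
  have hq' : (2 : ℝ) ≤ Nat.card (G ⧸ H) := by exact_mod_cast hq
  refine ⟨δ, hδ, fun hne => ?_, h3, ?_⟩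
  · by_contra h0
    have h0' : (shiftMoves T U H δ).card = 0 := by omega
    rw [h0'] at h2
    have := hne.card_pos
    omega
  · rw [shiftDensity, max_mul_of_nonneg _ _ (by positivity)]
    refine max_le ?_ ?_
    · rw [div_mul_eq_mul_div, div_le_iff₀ (by linarith)]; linarith
    · rw [div_mul_eq_mul_div, div_le_iff₀ (by positivity)]; linarith

theorem shiftDensity_le_one [Finite G] (hT0 : (0 : G) ∈ T) (hgen : AddSubgroup.closure (T : Set G) = ⊤)
    {H : AddSubgroup G} (hH : H ≠ ⊤) : shiftDensity T H ≤ 1 := by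
  have := Fintype.ofFinite (G ⧸ H)
  have hs1 := one_le_classCount hT0 hgen hH
  have hle : classCount T H + 1 ≤ Nat.card (G ⧸ H) := by
    have h2 := two_le_card_image_mk hT0 hgen hH
    have h3 := Finset.card_le_univ (T.image (QuotientAddGroup.mk' H))
    rw [Nat.card_eq_fintype_card, classCount]; omega
  have hs1' : (1 : ℝ) ≤ classCount T H := by exact_mod_cast hs1
  have hle' : (classCount T H : ℝ) + 1 ≤ Nat.card (G ⧸ H) := by exact_mod_cast hle
  refine max_le ?_ ?_
  · rw [div_le_one (by linarith)]; linarith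
  · rw [div_le_one (by linarith)]; linarith

theorem exists_cops [Finite G] (hT0 : (0 : G) ∈ T) (hneg : ∀ x ∈ T, -x ∈ T) (hodd : Odd (Nat.card G))
    (hgen : AddSubgroup.closure (T : Set G) = ⊤) {C : ℝ} (h3 : 3 ≤ Nat.card G)
    (hC0 : 0.8577 ≤ C) (hC1 : Real.sqrt (2 / Real.exp 1) ≤ C)
    (hC : ∀ H : AddSubgroup G, H ≠ ⊥ → 5 ≤ Nat.card H ∨ Nat.card H = 3 ∧ 0.8681 ≤ C) :
    ∃ K : ℕ, (K : ℝ) ≤ C * Real.sqrt (Nat.card G) + 5 / 2 ∧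
      ∀ d : Fin K → G, CopsCatch T T d := by
  have h3' : (3 : ℝ) ≤ Nat.card G := by exact_mod_cast h3
  have hbt : (⊥ : AddSubgroup G) ≠ ⊤ := by
    intro h
    have := AddSubgroup.card_bot (G := G)
    rw [h, AddSubgroup.card_top] at this
    omega
  have : Nonempty {H : AddSubgroup G // H ≠ ⊤} := ⟨⟨⊥, hbt⟩⟩
  obtain ⟨⟨H, hH⟩, hmin⟩ := Finite.exists_min
    (fun H : {H : AddSubgroup G // H ≠ ⊤} => shiftDensity T H)
  have hmin' : ∀ H', H' ≠ ⊤ → shiftDensity T H ≤ shiftDensity T H' := fun H' h => hmin ⟨H', h⟩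
  have hs1 : (1 : ℝ) ≤ classCount T H := by exact_mod_cast one_le_classCount hT0 hgen hH
  have hcard : (T.card : ℝ) ≤ Nat.card H * ((classCount T H : ℝ) + 1) := by
    exact_mod_cast card_le_mul_classCount hT0 hgen hH
  have hmulcard : (Nat.card H : ℝ) * Nat.card (G ⧸ H) = Nat.card G := by
    rw [mul_comm]; exact_mod_cast (AddSubgroup.card_eq_card_quotient_mul_card_addSubgroup H).symm
  have hgood : ∀ ρ : ℝ, ρ ≤ shiftDensity T H → ∀ U ⊆ T, ∀ H : AddSubgroup G, H ≠ ⊤ → ∃ δ ∉ H,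
      (U.Nonempty → 1 ≤ (shiftMoves T U H δ).card) ∧
      (3 ≤ U.card → 2 ≤ (shiftMoves T U H δ).card) ∧
      ρ * U.card ≤ (shiftMoves T U H δ).card := by
    intro ρ hρ U hU H' hH'
    obtain ⟨δ, hδ, g1, g2, g3⟩ := exists_shiftMoves hT0 hneg hodd hgen hU hH'
    refine ⟨δ, hδ, g1, g2, le_trans ?_ g3⟩
    have := hρ.trans (hmin' H' hH')
    gcongr
  have main : ∀ M ρ : ℝ, 0 < ρ → ρ ≤ shiftDensity T H → T.card ≤ M → 2 ≤ M * ρ →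
      copCost M ρ ≤ C * Real.sqrt (Nat.card G) + 1 / 2 →
      ∃ K : ℕ, (K : ℝ) ≤ C * Real.sqrt (Nat.card G) + 5 / 2 ∧
        ∀ d : Fin K → G, CopsCatch T T d := by
    intro M ρ hρ0 hρ hM hMρ hcost
    have hρ1 := hρ.trans (shiftDensity_le_one hT0 hgen hH)
    obtain ⟨k, i, hki, hK⟩ := exists_nat_copCost hρ0 hρ1 hM hMρ
    exact ⟨k + i, by linarith, CopsCatch.of_card_mul_pow_lt hρ1 (hgood ρ hρ) k i T subset_rfl hki⟩
  by_cases hHbot : H = ⊥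
  · subst hHbot
    rw [AddSubgroup.card_bot, Nat.cast_one, one_mul] at hcard hmulcard
    set s : ℝ := ((classCount T (⊥ : AddSubgroup G) : ℕ) : ℝ)
    set n : ℝ := ((Nat.card G : ℕ) : ℝ)
    by_cases hle : 2 * (n - 1) ≤ s * (s + 1)
    · refine main (s + 1) (s / (n - 1)) ?_ ?_ hcard ?_ ?_
      · have : 0 < n - 1 := by linarith
        positivity
      · rw [← hmulcard]; exact le_max_left _ _
      · rw [mul_div_assoc', le_div_iff₀ (by linarith)]; linarith
      · refine (copCost_self_le hs1 h3' hle).trans ?_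
        gcongr
    -- Here `s(s+1) < 2(n-1)`, so `T` is small enough for removal in pairs alone, at about `√(n/2)`
    -- cops.
    · refine ⟨T.card / 2 + 1, ?_, CopsCatch.of_card_lt (fun U hU H' hH' => ?_) _ T subset_rfl
        (by omega)⟩
      · have h1 : ((T.card / 2 : ℕ) : ℝ) ≤ T.card / 2 := Nat.cast_div_le
        have h2 : (s + 1 / 2) / 2 ≤ 0.8577 * Real.sqrt n := by
          rw [← div_le_iff₀' (by norm_num)]
          apply Real.le_sqrt_of_sq_le
          rw [div_pow, div_le_iff₀ (by norm_num)]; nlinarith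
        have h4 : 0.8577 * Real.sqrt n ≤ C * Real.sqrt n := by gcongr
        push_cast; linarith
      · obtain ⟨δ, hδ, g1, g2, -⟩ := hgood _ le_rfl U hU H' hH'
        exact ⟨δ, hδ, g1, g2⟩
  · have hq : 3 ≤ Nat.card (G ⧸ H) := by
      have h1 : Odd (Nat.card (G ⧸ H)) :=
        Odd.of_dvd_nat hodd (AddSubgroup.card_quotient_dvd_card H)
      have h2 : Nat.card (G ⧸ H) ≠ 1 := fun h => hH (AddSubgroup.index_eq_one.1 h)
      obtain ⟨m, hm⟩ := h1
      omega
    have hh : (5 : ℝ) ≤ Nat.card H ∨ (Nat.card H : ℝ) = 3 ∧ 0.8681 ≤ C := by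
      exact_mod_cast hC H hHbot
    obtain ⟨hM, hcost⟩ := copCost_quotient_le (q := Nat.card (G ⧸ H)) hC0 hh hs1
      (by exact_mod_cast hq)
    rw [hmulcard] at hcost
    refine main _ (shiftDensity T H) ?_ le_rfl hcard hM hcost
    exact lt_of_lt_of_le (by positivity) (le_max_right _ _)

end Quotient

/-! ### Conclusion -/

theorem corollary13 {G : Type*} [AddCommGroup G] [Finite G] (S : Set G)
    (hgen : AddSubgroup.closure S = ⊤) (h0 : (0 : G) ∉ S) (hsymm : -S = S)
    (p : ℕ) (hp : IsLeast {q : ℕ | q.Prime ∧ q ∣ Nat.card G} p) :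
    (p = 3 →
      (copNumber (SimpleGraph.addCayley S) : ℝ) ≤
        Real.sqrt (3 / (2 * (Real.sqrt 3 - 1) * Real.exp 1)) * Real.sqrt (Nat.card G : ℝ) + 5 / 2) ∧
    (5 ≤ p →
      (copNumber (SimpleGraph.addCayley S) : ℝ) ≤
        Real.sqrt (2 / Real.exp 1) * Real.sqrt (Nat.card G : ℝ) + 5 / 2) ∧
    |Real.sqrt (3 / (2 * (Real.sqrt 3 - 1) * Real.exp 1)) - 0.8682| < 0.00005 ∧
    |Real.sqrt (2 / Real.exp 1) - 0.8578| < 0.00005 := by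
  classical
  have := Fintype.ofFinite G
  obtain ⟨a1, a2⟩ := sqrt_two_div_exp_bounds
  obtain ⟨b1, b2⟩ := sqrt_three_div_bounds
  have hpp : p.Prime := hp.1.1
  have hpn : p ∣ Nat.card G := hp.1.2
  have key : ∀ C : ℝ, 3 ≤ p → 0.8577 ≤ C → Real.sqrt (2 / Real.exp 1) ≤ C →
      (5 ≤ p ∨ 0.8681 ≤ C) →
      (copNumber (SimpleGraph.addCayley S) : ℝ) ≤ C * Real.sqrt (Nat.card G : ℝ) + 5 / 2 := by
    intro C h3 hC0 hC1 hC
    have hodd : Odd (Nat.card G) := by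
      rw [← Nat.not_even_iff_odd]
      intro h
      have := hp.2 ⟨Nat.prime_two, h.two_dvd⟩
      omega
    set T : Finset G := insert 0 S.toFinset
    have hT : ∀ x, x ∈ T ↔ x = 0 ∨ x ∈ S := fun x => by simp [T]
    have hneg : ∀ x ∈ T, -x ∈ T := fun x hx => by
      rwa [hT, neg_eq_zero, ← Set.mem_neg, hsymm, ← hT]
    have hgenT : AddSubgroup.closure (T : Set G) = ⊤ :=
      top_le_iff.1 (hgen ▸ AddSubgroup.closure_mono fun x hx => by simp [hT, hx])
    obtain ⟨K, hK, hcatch⟩ := exists_cops ((hT 0).2 (Or.inl rfl)) hneg hodd hgenT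
      (h3.trans (Nat.le_of_dvd Nat.card_pos hpn)) hC0 hC1 (fun H hH => by
        have h1 : Nat.card H ≠ 1 := fun h => hH (AddSubgroup.card_eq_one.1 h)
        have hdvd := AddSubgroup.card_addSubgroup_dvd_card H
        have h2 : p ≤ Nat.card H :=
          (hp.2 ⟨Nat.minFac_prime h1, (Nat.minFac_dvd _).trans hdvd⟩).trans
            (Nat.minFac_le Nat.card_pos)
        obtain ⟨m, hm⟩ := Odd.of_dvd_nat hodd hdvd
        rcases hC with hC | hC
        · left; omega
        · by_cases h : Nat.card H = 3
          · exact Or.inr ⟨h, hC⟩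
          · left; omega)
    refine le_trans ?_ hK
    exact_mod_cast Nat.sInf_le (copsWin_of_copsCatch h0 hsymm hT hcatch)
  refine ⟨fun h => key _ h.ge (by linarith) (by linarith) (Or.inr (by linarith)),
    fun h => key _ (by omega) (by linarith) le_rfl (Or.inl h), ?_, ?_⟩
  · rw [abs_lt]; constructor <;> linarith
  · rw [abs_lt]; constructor <;> linarith
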